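/- For a (complex, not necessarily unital) C*-algebra $A$ let $K_*(A) = K_0(A)\oplus K_1(A)$ denote its topological $K$-theory, and for a $*$-homomorphism $f : A \to B$ let $f_* : K_*(A)\to K_*(B)$ denote the induced homomorphism. **Theorem (Hirshberg).** Suppose that $A$ is a C*-algebra with $K_*(A)$ countable. Then there exists an ascending sequence $$F_1 \subseteq F_2 \subseteq F_3 \subseteq \cdots$$ of separable C*-subalgebras of $A$, with inclusion maps $\iota_n : F_n \to A$, such that each map $\iota_{n*} : K_*(F_n) \to K_*(A)$ is surjective and such that the following holds. Let $\theta A = \varinjlim F_n$, realized in $A$ as the closure $\overline{\bigcup_n F_n}$. Then $\theta A$ is a separable C*-subalgebra of $A$, and the inclusion $\iota : \theta A \to A$ induces an isomorphism $$\iota_* : K_*(\theta A) \overset{\cong}{\longrightarrow} K_*(A).$$ -/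

import Mathlib

namespace CStarKTheory

open Matrix

/-! ### Projections in matrix algebras and `K₀` -/

section KZero

/-- A projection in a matrix algebra `M_n(B)`, for some `n`. -/
structure MatProj (B : Type*) [Ring B] [StarRing B] where
  size : ℕ
  mat : Matrix (Fin size) (Fin size) B
  isProj : IsStarProjection mat

/-- Murray–von Neumann equivalence of square matrices, possibly of different sizes:
`p = v v*` and `q = v* v` for some rectangular matrix `v`. -/
def MvN {B : Type*} [Ring B] [StarRing B] {ι κ : Type} [Fintype ι] [Fintype κ]
    (p : Matrix ι ι B) (q : Matrix κ κ B) : Prop :=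
  ∃ v : Matrix ι κ B, v * vᴴ = p ∧ vᴴ * v = q

theorem MvN.refl {B : Type*} [Ring B] [StarRing B] {ι : Type} [Fintype ι]
    {p : Matrix ι ι B} (hp : IsStarProjection p) : MvN p p := by
  have h1 : pᴴ = p := hp.isSelfAdjoint
  exact ⟨p, by rw [h1]; exact hp.isIdempotentElem, by rw [h1]; exact hp.isIdempotentElem⟩

theorem MvN.symm {B : Type*} [Ring B] [StarRing B] {ι κ : Type} [Fintype ι] [Fintype κ]
    {p : Matrix ι ι B} {q : Matrix κ κ B} (h : MvN p q) : MvN q p := by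
  obtain ⟨v, h1, h2⟩ := h
  exact ⟨vᴴ, by simpa using h2, by simpa using h1⟩

theorem MvN.trans {B : Type*} [Ring B] [StarRing B] {ι κ l : Type} [Fintype ι] [Fintype κ]
    [Fintype l] {p : Matrix ι ι B} {q : Matrix κ κ B} {r : Matrix l l B}
    (hp : IsStarProjection p) (hr : IsStarProjection r)
    (h : MvN p q) (h' : MvN q r) : MvN p r := by
  obtain ⟨v, h1, h2⟩ := h
  obtain ⟨w, h3, h4⟩ := h'
  refine ⟨v * w, ?_, ?_⟩
  · calc v * w * (v * w)ᴴ = v * (w * wᴴ) * vᴴ := by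
          rw [conjTranspose_mul]; simp only [Matrix.mul_assoc]
      _ = (v * vᴴ) * (v * vᴴ) := by rw [h3, ← h2]; simp only [Matrix.mul_assoc]
      _ = p := by rw [h1]; exact hp.isIdempotentElem
  · calc (v * w)ᴴ * (v * w) = wᴴ * (vᴴ * v) * w := by
          rw [conjTranspose_mul]; simp only [Matrix.mul_assoc]
      _ = (wᴴ * w) * (wᴴ * w) := by rw [h2, ← h3]; simp only [Matrix.mul_assoc]
      _ = r := by rw [h4]; exact hr.isIdempotentElem

/-- Relabelling the indices does not change the Murray–von Neumann class of a projection. -/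
theorem MvN.reindex {B : Type*} [Ring B] [StarRing B] {ι κ : Type} [Fintype ι] [Fintype κ]
    {p : Matrix ι ι B} (hp : IsStarProjection p) (e : κ ≃ ι) : MvN p (p.submatrix e e) := by
  have h1 : pᴴ = p := hp.isSelfAdjoint
  have h2 : p * p = p := hp.isIdempotentElem
  refine ⟨p.submatrix id e, ?_, ?_⟩
  · rw [conjTranspose_submatrix, h1, submatrix_mul_equiv, h2, submatrix_id_id]
  · rw [conjTranspose_submatrix, h1]
    have := submatrix_mul_equiv p p e (Equiv.refl ι) e
    simpa [h2] using this

theorem MvN.blockDiag {B : Type*} [Ring B] [StarRing B] {ι κ ι' κ' : Type} [Fintype ι]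
    [Fintype κ] [Fintype ι'] [Fintype κ'] {p : Matrix ι ι B} {q : Matrix κ κ B}
    {p' : Matrix ι' ι' B} {q' : Matrix κ' κ' B} (h : MvN p q) (h' : MvN p' q') :
    MvN (fromBlocks p 0 0 p') (fromBlocks q 0 0 q') := by
  obtain ⟨v, h1, h2⟩ := h
  obtain ⟨w, h3, h4⟩ := h'
  refine ⟨fromBlocks v 0 0 w, ?_, ?_⟩ <;>
    simp [fromBlocks_conjTranspose, fromBlocks_multiply, h1, h2, h3, h4]

theorem isStarProjection_fromBlocks {B : Type*} [Ring B] [StarRing B] {ι κ : Type} [Fintype ι]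
    [Fintype κ] {p : Matrix ι ι B} {q : Matrix κ κ B} (hp : IsStarProjection p)
    (hq : IsStarProjection q) : IsStarProjection (fromBlocks p 0 0 q) := by
  have h1 : pᴴ = p := hp.isSelfAdjoint
  have h2 : p * p = p := hp.isIdempotentElem
  have h3 : qᴴ = q := hq.isSelfAdjoint
  have h4 : q * q = q := hq.isIdempotentElem
  refine ⟨?_, ?_⟩
  · simp [IsIdempotentElem, fromBlocks_multiply, h2, h4]
  · change (fromBlocks p 0 0 q)ᴴ = _
    simp [fromBlocks_conjTranspose, h1, h3]

theorem isStarProjection_submatrix {B : Type*} [Ring B] [StarRing B] {ι κ : Type} [Fintype ι]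
    [Fintype κ] {p : Matrix ι ι B} (hp : IsStarProjection p) (e : κ ≃ ι) :
    IsStarProjection (p.submatrix e e) := by
  have h1 : pᴴ = p := hp.isSelfAdjoint
  have h2 : p * p = p := hp.isIdempotentElem
  refine ⟨?_, ?_⟩
  · rw [IsIdempotentElem, submatrix_mul_equiv, h2]
  · change (p.submatrix e e)ᴴ = _
    rw [conjTranspose_submatrix, h1]

variable {B : Type*} [Ring B] [StarRing B]

instance MatProj.setoid (B : Type*) [Ring B] [StarRing B] : Setoid (MatProj B) where
  r p q := MvN p.mat q.mat
  iseqv :=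
    { refl := fun p => MvN.refl p.isProj
      symm := fun h => h.symm
      trans := fun {p _ r} h h' => h.trans p.isProj r.isProj h' }

/-- The block diagonal sum `p ⊕ q` of two projections. -/
def MatProj.sum (p q : MatProj B) : MatProj B where
  size := p.size + q.size
  mat := (fromBlocks p.mat 0 0 q.mat).submatrix finSumFinEquiv.symm finSumFinEquiv.symm
  isProj := isStarProjection_submatrix (isStarProjection_fromBlocks p.isProj q.isProj) _

/-- The empty projection. -/
def MatProj.empty (B : Type*) [Ring B] [StarRing B] : MatProj B where
  size := 0
  mat := 0
  isProj := ⟨by simp [IsIdempotentElem], by simp [IsSelfAdjoint]⟩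

/-- `V(B)`: Murray–von Neumann equivalence classes of projections in matrices over `B`. -/
def V (B : Type*) [Ring B] [StarRing B] : Type _ := Quotient (MatProj.setoid B)

/-- The class of a projection in `V(B)`. -/
def V.mk (p : MatProj B) : V B := Quotient.mk _ p

theorem MatProj.sum_mvN (p q : MatProj B) :
    MvN (fromBlocks p.mat 0 0 q.mat) (p.sum q).mat :=
  MvN.reindex (isStarProjection_fromBlocks p.isProj q.isProj) _

theorem V.mk_eq_of_mvN {p q : MatProj B} (h : MvN p.mat q.mat) : V.mk p = V.mk q :=
  Quotient.sound h

theorem MatProj.sum_congr {p p' q q' : MatProj B} (h : MvN p.mat p'.mat)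
    (h' : MvN q.mat q'.mat) : MvN (p.sum q).mat (p'.sum q').mat :=
  ((p.sum_mvN q).symm.trans (p.sum q).isProj (isStarProjection_fromBlocks p'.isProj q'.isProj)
    (h.blockDiag h')).trans (p.sum q).isProj (p'.sum q').isProj (p'.sum_mvN q')

theorem MatProj.sum_comm_mvN (p q : MatProj B) : MvN (p.sum q).mat (q.sum p).mat := by
  have h : MvN (fromBlocks p.mat 0 0 q.mat) (fromBlocks q.mat 0 0 p.mat) := by
    have := MvN.reindex (isStarProjection_fromBlocks p.isProj q.isProj)
      (Equiv.sumComm (Fin q.size) (Fin p.size))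
    simpa using this
  exact ((p.sum_mvN q).symm.trans (p.sum q).isProj
    (isStarProjection_fromBlocks q.isProj p.isProj) h).trans (p.sum q).isProj (q.sum p).isProj
      (q.sum_mvN p)

theorem MatProj.empty_sum_mvN (p : MatProj B) : MvN ((MatProj.empty B).sum p).mat p.mat := by
  have : IsEmpty (Fin (MatProj.empty B).size) := by simp only [MatProj.empty]; infer_instance
  have h : MvN (fromBlocks (MatProj.empty B).mat 0 0 p.mat) p.mat := by
    have := MvN.reindex (isStarProjection_fromBlocks (MatProj.empty B).isProj p.isProj)
      (Equiv.emptySum (Fin (MatProj.empty B).size) (Fin p.size)).symm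
    convert this using 1
    ext i j
    simp
  exact ((MatProj.empty B).sum_mvN p).symm.trans ((MatProj.empty B).sum p).isProj p.isProj h

theorem MatProj.sum_assoc_mvN (p q r : MatProj B) :
    MvN ((p.sum q).sum r).mat (p.sum (q.sum r)).mat := by
  have hpq := isStarProjection_fromBlocks p.isProj q.isProj
  have hqr := isStarProjection_fromBlocks q.isProj r.isProj
  have hl := isStarProjection_fromBlocks hpq r.isProj
  have hr := isStarProjection_fromBlocks p.isProj hqr
  have h1 : MvN ((p.sum q).sum r).mat
      (fromBlocks (fromBlocks p.mat 0 0 q.mat) 0 0 r.mat) :=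
    ((p.sum q).sum_mvN r).symm.trans ((p.sum q).sum r).isProj hl
      ((p.sum_mvN q).symm.blockDiag (MvN.refl r.isProj))
  have h2 : MvN (fromBlocks p.mat 0 0 (fromBlocks q.mat 0 0 r.mat))
      (p.sum (q.sum r)).mat :=
    ((MvN.refl p.isProj).blockDiag (q.sum_mvN r)).trans hr (p.sum (q.sum r)).isProj
      (p.sum_mvN (q.sum r))
  have h3 : MvN (fromBlocks (fromBlocks p.mat 0 0 q.mat) 0 0 r.mat)
      (fromBlocks p.mat 0 0 (fromBlocks q.mat 0 0 r.mat)) := by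
    have := MvN.reindex hl (Equiv.sumAssoc (Fin p.size) (Fin q.size) (Fin r.size)).symm
    convert this using 1
    ext (i | i | i) (j | j | j) <;> simp
  exact (h1.trans ((p.sum q).sum r).isProj hr h3).trans ((p.sum q).sum r).isProj
    (p.sum (q.sum r)).isProj h2

instance : Zero (V B) := ⟨V.mk (MatProj.empty B)⟩

/-- Addition in `V(B)` is induced by the block diagonal sum. -/
instance : Add (V B) :=
  ⟨Quotient.map₂ MatProj.sum fun _ _ h _ _ h' => MatProj.sum_congr h h'⟩

instance : AddCommMonoid (V B) where
  add_assoc := by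
    rintro ⟨p⟩ ⟨q⟩ ⟨r⟩
    exact V.mk_eq_of_mvN (p.sum_assoc_mvN q r)
  zero_add := by
    rintro ⟨p⟩
    exact V.mk_eq_of_mvN p.empty_sum_mvN
  add_zero := by
    rintro ⟨p⟩
    exact V.mk_eq_of_mvN (((p.sum_comm_mvN _).trans (p.sum _).isProj p.isProj p.empty_sum_mvN))
  add_comm := by
    rintro ⟨p⟩ ⟨q⟩
    exact V.mk_eq_of_mvN (p.sum_comm_mvN q)
  nsmul := nsmulRec

variable {C : Type*} [Ring C] [StarRing C] [Algebra ℂ B] [Algebra ℂ C]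

/-- Entrywise application of a unital `*`-homomorphism to a projection. -/
def MatProj.map (f : B →⋆ₐ[ℂ] C) (p : MatProj B) : MatProj C where
  size := p.size
  mat := p.mat.map f
  isProj := by
    have h1 : p.matᴴ = p.mat := p.isProj.isSelfAdjoint
    have h2 : p.mat * p.mat = p.mat := p.isProj.isIdempotentElem
    refine ⟨?_, ?_⟩
    · rw [IsIdempotentElem, ← Matrix.map_mul, h2]
    · change (p.mat.map f)ᴴ = _
      rw [← conjTranspose_map f (fun x => map_star f x), h1]

/-- The homomorphism `V(B) → V(C)`, `[p] ↦ [f(p)]`. -/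
def V.map (f : B →⋆ₐ[ℂ] C) : V B →+ V C where
  toFun := Quotient.map (MatProj.map f) (by
    rintro p q ⟨v, h1, h2⟩
    exact ⟨v.map f,
      (by rw [← conjTranspose_map f (fun x => map_star f x), ← Matrix.map_mul, h1] :
        v.map f * (v.map f)ᴴ = p.mat.map f),
      (by rw [← conjTranspose_map f (fun x => map_star f x), ← Matrix.map_mul, h2] :
        (v.map f)ᴴ * v.map f = q.mat.map f)⟩)
  map_zero' := by
    refine V.mk_eq_of_mvN ⟨0, ?_, ?_⟩ <;>
    · ext i
      exact i.elim0
  map_add' := by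
    rintro ⟨p⟩ ⟨q⟩
    have h : ((fromBlocks p.mat 0 0 q.mat).submatrix finSumFinEquiv.symm
        finSumFinEquiv.symm).map f = (fromBlocks (p.mat.map f) 0 0 (q.mat.map f)).submatrix
        finSumFinEquiv.symm finSumFinEquiv.symm := by
      rw [← submatrix_map, fromBlocks_map, Matrix.map_zero f (map_zero f),
        Matrix.map_zero f (map_zero f)]
    have h' : (p.sum q).map f = (p.map f).sum (q.map f) := by
      simp only [MatProj.map, MatProj.sum, h]
      rfl
    exact congrArg V.mk h'

/-- The Grothendieck group of `V(B)`; for a unital C*-algebra `B` this is `K₀(B)`. -/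
abbrev K00 (B : Type*) [Ring B] [StarRing B] : Type _ := Algebra.GrothendieckAddGroup (V B)

/-- The homomorphism of Grothendieck groups induced by a unital `*`-homomorphism. -/
noncomputable def K00.map (f : B →⋆ₐ[ℂ] C) : K00 B →+ K00 C :=
  Algebra.GrothendieckAddGroup.lift (Algebra.GrothendieckAddGroup.of.comp (V.map f))

theorem K00.map_of (f : B →⋆ₐ[ℂ] C) (x : V B) :
    K00.map f (Algebra.GrothendieckAddGroup.of x) = Algebra.GrothendieckAddGroup.of (V.map f x) :=
  DFunLike.congr_fun (Algebra.GrothendieckAddGroup.lift.symm_apply_apply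
    (Algebra.GrothendieckAddGroup.of.comp (V.map f))) x

theorem K00.map_comp {D : Type*} [Ring D] [StarRing D] [Algebra ℂ D] (g : C →⋆ₐ[ℂ] D)
    (f : B →⋆ₐ[ℂ] C) : K00.map (g.comp f) = (K00.map g).comp (K00.map f) := by
  have hV : V.map (g.comp f) = (V.map g).comp (V.map f) := by
    ext ⟨p⟩
    rfl
  apply Algebra.GrothendieckAddGroup.lift.symm.injective
  ext x
  change K00.map (g.comp f) (Algebra.GrothendieckAddGroup.of x) =
    K00.map g (K00.map f (Algebra.GrothendieckAddGroup.of x))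
  rw [K00.map_of, K00.map_of, K00.map_of, hV]
  rfl

end KZero

/-! ### Unitary groups of matrix algebras and `K₁` -/

section KOne

/-- The matrix `u ⊕ 1_{m-n}` for a square matrix `u` of size `n ≤ m`. -/
def pad {B : Type*} [Zero B] [One B] {n : ℕ} (m : ℕ) (u : Matrix (Fin n) (Fin n) B) :
    Matrix (Fin m) (Fin m) B :=
  Matrix.of fun i j =>
    if h : (i : ℕ) < n ∧ (j : ℕ) < n then u ⟨i, h.1⟩ ⟨j, h.2⟩ else if i = j then 1 else 0

theorem pad_self {B : Type*} [Zero B] [One B] {n : ℕ} (u : Matrix (Fin n) (Fin n) B) :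
    pad n u = u := by
  ext i j
  simp [pad]

theorem pad_pad {B : Type*} [Zero B] [One B] {n m k : ℕ} (hnm : n ≤ m)
    (u : Matrix (Fin n) (Fin n) B) : pad k (pad m u) = pad k u := by
  ext i j
  simp only [pad, of_apply, Fin.ext_iff]
  split_ifs <;> first | rfl | omega

theorem pad_eq_fromBlocks {B : Type*} [Zero B] [One B] {n : ℕ} (k : ℕ)
    (u : Matrix (Fin n) (Fin n) B) :
    pad (n + k) u =
      (fromBlocks u 0 0 (1 : Matrix (Fin k) (Fin k) B)).submatrix finSumFinEquiv.symm
        finSumFinEquiv.symm := by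
  ext i j
  obtain ⟨i, rfl⟩ := finSumFinEquiv.surjective i
  obtain ⟨j, rfl⟩ := finSumFinEquiv.surjective j
  rcases i with i | i <;> rcases j with j | j <;>
    simp [pad, Fin.ext_iff, Matrix.one_apply] <;> omega

variable {B C : Type*}

theorem pad_one [Ring B] {n m : ℕ} (h : n ≤ m) :
    pad m (1 : Matrix (Fin n) (Fin n) B) = 1 := by
  obtain ⟨k, rfl⟩ := Nat.exists_eq_add_of_le h
  rw [pad_eq_fromBlocks, fromBlocks_one, submatrix_one_equiv]

theorem pad_mul [Ring B] {n m : ℕ} (h : n ≤ m) (u v : Matrix (Fin n) (Fin n) B) :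
    pad m (u * v) = pad m u * pad m v := by
  obtain ⟨k, rfl⟩ := Nat.exists_eq_add_of_le h
  simp only [pad_eq_fromBlocks, submatrix_mul_equiv, fromBlocks_multiply]
  simp

theorem pad_star [Ring B] [StarRing B] {n m : ℕ} (h : n ≤ m) (u : Matrix (Fin n) (Fin n) B) :
    pad m (star u) = star (pad m u) := by
  obtain ⟨k, rfl⟩ := Nat.exists_eq_add_of_le h
  simp only [pad_eq_fromBlocks, star_eq_conjTranspose, conjTranspose_submatrix,
    fromBlocks_conjTranspose]
  simp

theorem continuous_pad [Ring B] [TopologicalSpace B] {n m : ℕ} :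
    Continuous (pad m : Matrix (Fin n) (Fin n) B → Matrix (Fin m) (Fin m) B) := by
  refine continuous_matrix fun i j => ?_
  simp only [pad, of_apply]
  split_ifs <;> fun_prop

/-- The unitary group `U_n(B)` of the matrix algebra `M_n(B)`. The topology on `M_n(B)` is that of
entrywise convergence, which is the norm topology of the C*-algebra `M_n(B)`. -/
abbrev U (n : ℕ) (B : Type*) [CStarAlgebra B] : Type _ := unitary (Matrix (Fin n) (Fin n) B)

/-- The homomorphism `U_n(B) → U_m(B)`, `u ↦ u ⊕ 1_{m-n}`. -/
def U.pad [CStarAlgebra B] {n m : ℕ} (h : n ≤ m) : U n B →* U m B :=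
  (Unitary.map (R := Matrix (Fin n) (Fin n) B) (S := Matrix (Fin m) (Fin m) B)
    { toFun := CStarKTheory.pad m
      map_one' := pad_one h
      map_mul' := pad_mul h
      map_star' := pad_star h }).toMonoidHom

/-- The homomorphism `U_n(B) → U_n(C)` given by entrywise application of a unital
`*`-homomorphism. -/
def U.map [CStarAlgebra B] [CStarAlgebra C] (n : ℕ) (f : B →⋆ₐ[ℂ] C) : U n B →* U n C :=
  (Unitary.map (R := Matrix (Fin n) (Fin n) B) (S := Matrix (Fin n) (Fin n) C)
    { toFun := fun u => Matrix.map u f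
      map_one' := Matrix.map_one f (map_zero f) (map_one f)
      map_mul' := fun _ _ => Matrix.map_mul
      map_star' := fun _ => conjTranspose_map f (fun x => map_star f x) }).toMonoidHom

theorem U.continuous_pad [CStarAlgebra B] {n m : ℕ} (h : n ≤ m) :
    Continuous (U.pad h : U n B →* U m B) :=
  Continuous.subtype_mk (CStarKTheory.continuous_pad.comp continuous_subtype_val) _

theorem U.continuous_map [CStarAlgebra B] [CStarAlgebra C] (n : ℕ) (f : B →⋆ₐ[ℂ] C) :
    Continuous (U.map n f) := by
  have hf : Continuous f :=
    AddMonoidHomClass.continuous_of_bound f 1 fun a => by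
      simpa only [one_mul] using NonUnitalStarAlgHom.norm_apply_le f a
  exact Continuous.subtype_mk (continuous_subtype_val.matrix_map hf) _

/-- The group `π₀(U_n(B)) = U_n(B) / U_n(B)₀` of path components of the unitary group. -/
abbrev PiZeroU (n : ℕ) (B : Type*) [CStarAlgebra B] : Type _ :=
  U n B ⧸ Subgroup.pathComponentOne (U n B)

theorem pathComponentOne_le_comap {G H : Type*} [Group G] [TopologicalSpace G]
    [IsTopologicalGroup G] [Group H] [TopologicalSpace H] [IsTopologicalGroup H] (f : G →* H)
    (hf : Continuous f) :
    Subgroup.pathComponentOne G ≤ (Subgroup.pathComponentOne H).comap f := by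
  intro x hx
  have hx' : Joined (1 : G) x := hx
  have : Joined (f 1) (f x) := hx'.map hf
  rw [map_one] at this
  exact this

/-- The stabilization homomorphism `π₀(U_n(B)) → π₀(U_m(B))`. -/
def PiZeroU.pad [CStarAlgebra B] (n m : ℕ) (h : n ≤ m) : PiZeroU n B →* PiZeroU m B :=
  QuotientGroup.map _ _ (U.pad h) (pathComponentOne_le_comap _ (U.continuous_pad h))

/-- The homomorphism `π₀(U_n(B)) → π₀(U_n(C))` induced by a unital `*`-homomorphism. -/
def PiZeroU.map [CStarAlgebra B] [CStarAlgebra C] (n : ℕ) (f : B →⋆ₐ[ℂ] C) :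
    PiZeroU n B →* PiZeroU n C :=
  QuotientGroup.map _ _ (U.map n f) (pathComponentOne_le_comap _ (U.continuous_map n f))

instance [CStarAlgebra B] :
    DirectedSystem (fun n => PiZeroU n B) (fun n m h => PiZeroU.pad (B := B) n m h) where
  map_self := by
    rintro n ⟨u⟩
    exact congrArg (QuotientGroup.mk' _) (Subtype.ext (pad_self u.1) : U.pad le_rfl u = u)
  map_map := by
    rintro k m n hnm hmk ⟨u⟩
    exact congrArg (QuotientGroup.mk' _) (Subtype.ext (pad_pad hnm u.1) :
      U.pad hmk (U.pad hnm u) = U.pad (hnm.trans hmk) u)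

/-- `lim π₀(U_n(B))`; for a unital C*-algebra `B` this is the group
`K₁(B) = U_∞(B) / U_∞(B)₀`. -/
abbrev K11 (B : Type*) [CStarAlgebra B] : Type _ :=
  DirectLimit (fun n => PiZeroU n B) (fun n m h => PiZeroU.pad (B := B) n m h)

/-- The homomorphism `lim π₀(U_n(B)) → lim π₀(U_n(C))` induced by a unital `*`-homomorphism. -/
noncomputable def K11.map [CStarAlgebra B] [CStarAlgebra C] (f : B →⋆ₐ[ℂ] C) : K11 B →* K11 C :=
  MonoidHom.mk' (DirectLimit.map _ _ (fun n => PiZeroU.map n f) (by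
    rintro n m h ⟨u⟩
    refine congrArg (QuotientGroup.mk' _) (Subtype.ext ?_ :
      U.pad h (U.map n f u) = U.map m f (U.pad h u))
    change CStarKTheory.pad m (Matrix.map u.1 f) = Matrix.map (CStarKTheory.pad m u.1) f
    ext i j
    simp only [CStarKTheory.pad, of_apply, Matrix.map_apply]
    split_ifs <;> simp)) (by
    refine DirectLimit.induction₂ _ fun n x y => ?_
    simp only [DirectLimit.mul_def, DirectLimit.map_def, map_mul])

end KOne

/-! ### `K_*` of a possibly non-unital C*-algebra -/

section KStar

/-- The canonical unital `*`-homomorphism `A⁺ → ℂ`, `(z, a) ↦ z`, on the unitization `A⁺`. -/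
def scalarHom (A : Type*) [NonUnitalCStarAlgebra A] : Unitization ℂ A →⋆ₐ[ℂ] ℂ where
  toAlgHom := Unitization.fstHom ℂ A
  map_star' := Unitization.fst_star

/-- `K₀(A)`, the kernel of `K₀(A⁺) → K₀(ℂ)`. -/
noncomputable def K0 (A : Type*) [NonUnitalCStarAlgebra A] :
    AddSubgroup (K00 (Unitization ℂ A)) :=
  (K00.map (scalarHom A)).ker

/-- `K₁(A)`, by definition `K₁(A⁺) = U_∞(A⁺) / U_∞(A⁺)₀`. -/
abbrev K1 (A : Type*) [NonUnitalCStarAlgebra A] : Type _ := K11 (Unitization ℂ A)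

variable {A B : Type*} [NonUnitalCStarAlgebra A] [NonUnitalCStarAlgebra B]

theorem K0.map_mem (f : A →⋆ₙₐ[ℂ] B) (x : K00 (Unitization ℂ A)) (hx : x ∈ K0 A) :
    K00.map (Unitization.starMap f) x ∈ K0 B := by
  have h : (scalarHom B).comp (Unitization.starMap f) = scalarHom A := by
    ext a
    change (Unitization.starMap f (a : Unitization ℂ A)).fst = (a : Unitization ℂ A).fst
    simp
  have hx' : K00.map (scalarHom A) x = 0 := hx
  change K00.map (scalarHom B) (K00.map (Unitization.starMap f) x) = 0
  rw [← AddMonoidHom.comp_apply, ← K00.map_comp, h, hx']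

/-- The homomorphism `K₀(A) → K₀(B)` induced by a `*`-homomorphism. -/
noncomputable def K0.map (f : A →⋆ₙₐ[ℂ] B) : K0 A →+ K0 B :=
  ((K00.map (Unitization.starMap f)).comp (K0 A).subtype).codRestrict (K0 B)
    fun x => K0.map_mem f x x.2

/-- The homomorphism `K₁(A) → K₁(B)` induced by a `*`-homomorphism. -/
noncomputable def K1.map (f : A →⋆ₙₐ[ℂ] B) : K1 A →* K1 B :=
  K11.map (Unitization.starMap f)

/-- `K_*(A) = K₀(A) ⊕ K₁(A)`, written additively. -/
abbrev KStar (A : Type*) [NonUnitalCStarAlgebra A] : Type _ := K0 A × Additive (K1 A)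

/-- The homomorphism `f_* : K_*(A) → K_*(B)` of degree zero induced by a `*`-homomorphism. -/
noncomputable def KStar.map (f : A →⋆ₙₐ[ℂ] B) : KStar A →+ KStar B :=
  (K0.map f).prodMap (MonoidHom.toAdditive (K1.map f))

end KStar

end CStarKTheory

/-!
The proof is a Löwenheim–Skolem argument. Countably many elements of `A` suffice to write down
representatives of all classes in `K_*(A)`, so every closed subalgebra containing them surjects on
`K_*` (`KStar.exists_countable_surjective`); `F 0` is a separable one.

A relation in the `K`-theory of `A` between given projections or unitaries is also witnessed by
countably many elements of `A`: the entries of a partial isometry, or of a path of unitaries at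
a dense set of times (`K00.exists_countable_witness`, `K11.exists_countable_witness`). Given a
separable `F`, choose countable families of projections and unitaries over `A⁺` that approximate
elements of `M_n(F⁺)` as well as all projections and unitaries over `A⁺` do
(`exists_countable_approx`), and let the next subalgebra contain `F`, the entries of these
families, and witnesses for all relations among them (`exists_isEnlargement`).

Let `θ` be the closure of the union of the resulting sequence. A projection over `θ⁺` lies in the
closure of the matrices over the `F k⁺`, so it is close to a member of one of the chosen families.
Close projections over `θ⁺` are equivalent and close unitaries over `θ⁺` are connected
(`MvN.eventually`, `U.eventually_joined`), so every class over `θ⁺` is given by members of these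
families. A relation between them that holds over `A` has been given a witness in `θ`, hence
`K_*(θ) → K_*(A)` is injective (`KStar.map_injective`).
-/

namespace CStarKTheory

open Matrix Topology Filter TopologicalSpace
open scoped Pointwise

universe u

/-! ### Nearby projections and nearby unitaries -/

section Perturbation

/-- An invertible element intertwining two projections makes them Murray–von Neumann equivalent:
the partial isometry is `p |z*|⁻¹ z`, the unitary part of the polar decomposition of `z` cut down
by `p`. -/
theorem exists_mul_star_eq_of_intertwines {D : Type*} [CStarAlgebra D] {p q z : D}
    (hp : IsStarProjection p) (hq : IsStarProjection q) (hz : IsUnit z) (h : p * z = z * q) :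
    ∃ v : D, v * star v = p ∧ star v * v = q := by
  let _ := CStarAlgebra.spectralOrder D
  have := CStarAlgebra.spectralOrderedRing D
  have hp1 : star p = p := hp.isSelfAdjoint
  have hp2 : p * p = p := hp.isIdempotentElem
  have hq1 : star q = q := hq.isSelfAdjoint
  have hq2 : q * q = q := hq.isIdempotentElem
  have h' : star z * p = q * star z := by
    have := congrArg star h
    simpa [hp1, hq1] using this
  have ha : IsStrictlyPositive (z * star z) :=
    IsStrictlyPositive.iff_of_unital.2 ⟨mul_star_self_nonneg z, hz.mul hz.star⟩
  have hcomm : Commute (z * star z) p := by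
    change z * star z * p = p * (z * star z)
    rw [mul_assoc, h', ← mul_assoc, ← mul_assoc, h]
  set b : D := (z * star z) ^ (-(1 / 2) : ℝ) with hb
  have hb1 : star b = b := (CFC.rpow_nonneg.isSelfAdjoint : IsSelfAdjoint b)
  have hbp : Commute b p := hcomm.cfc_nnreal _
  have hbb : b * b * (z * star z) = 1 := by
    rw [hb, ← CFC.rpow_add ha.isUnit]
    norm_num
    simpa [CFC.rpow_one (z * star z) ha.nonneg] using CFC.rpow_neg_mul_rpow 1 ha
  have hba : Commute b (z * star z) := (Commute.refl (z * star z)).cfc_nnreal _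
  -- `b * b` is the inverse of `z * star z`, so it can be cancelled in this order as well.
  have hbz : star z * (b * b) * z = 1 := by
    obtain ⟨w, hw⟩ := hz
    obtain ⟨s, hs⟩ := (hw ▸ w.isUnit.star : IsUnit (star z))
    have e : b * b * z = (↑s⁻¹ : D) := by
      rw [← hs] at hbb
      calc b * b * z = b * b * (z * s) * ↑s⁻¹ := by simp [mul_assoc]
        _ = _ := by rw [hbb, one_mul]
    rw [mul_assoc, e, ← hs, Units.mul_inv]
  refine ⟨p * b * z, ?_, ?_⟩
  · calc p * b * z * star (p * b * z) = p * (b * (z * star z) * b) * p := by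
          simp only [star_mul, hp1, hb1, mul_assoc]
      _ = p * (b * b * (z * star z)) * p := by
          rw [mul_assoc b (z * star z) b, ← hba.eq, ← mul_assoc b b]
      _ = p := by rw [hbb, mul_one, hp2]
  · have e : p * b * z = b * z * q := by rw [← hbp.eq, mul_assoc, h, mul_assoc]
    calc star (p * b * z) * (p * b * z) = q * (star z * (b * b) * z) * q := by
          rw [e]; simp only [star_mul, hq1, hb1, mul_assoc]
      _ = q := by rw [hbz, mul_one, hq2]

/-- Projections `q` close to `p` are equivalent to `p`, because `z = p q + (1 - p)(1 - q)` is close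
to `1`, hence invertible, and `p z = p q = z q`. -/
theorem eventually_exists_mul_star_eq {D : Type*} [CStarAlgebra D] {p : D}
    (hp : IsStarProjection p) :
    ∀ᶠ q in 𝓝 p, IsStarProjection q → ∃ v : D, v * star v = p ∧ star v * v = q := by
  have hp2 : p * p = p := hp.isIdempotentElem
  have hcont : Continuous fun q : D => p * q + (1 - p) * (1 - q) := by fun_prop
  have h1 : p * p + (1 - p) * (1 - p) = 1 := by
    simp only [mul_sub, sub_mul, hp2, mul_one, one_mul]; abel
  have hU : {x : D | IsUnit x} ∈ 𝓝 (p * p + (1 - p) * (1 - p)) :=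
    Units.isOpen.mem_nhds (by rw [h1]; exact isUnit_one)
  filter_upwards [hcont.continuousAt.preimage_mem_nhds hU] with q hz hq
  have hq2 : q * q = q := hq.isIdempotentElem
  refine exists_mul_star_eq_of_intertwines hp hq hz ?_
  simp only [mul_add, add_mul, mul_sub, sub_mul, mul_one, one_mul, ← mul_assoc, hp2]
  simp only [mul_assoc, hq2]
  abel

variable {B : Type*} [CStarAlgebra B]

/-- `eventually_exists_mul_star_eq` for the C*-algebra `CStarMatrix (Fin n) (Fin n) B`, whose
topology is by definition the entrywise one. -/
theorem MvN.eventually {n : ℕ} {p : Matrix (Fin n) (Fin n) B} (hp : IsStarProjection p) :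
    ∀ᶠ q in 𝓝 p, IsStarProjection q → MvN p q := by
  let _ := CStarAlgebra.spectralOrder B
  have := CStarAlgebra.spectralOrderedRing B
  have hp' : IsStarProjection (CStarMatrix.ofMatrix p) := ⟨hp.1, hp.2⟩
  have h : ∀ᶠ q in 𝓝 p, IsStarProjection (CStarMatrix.ofMatrix q) →
      ∃ v : CStarMatrix (Fin n) (Fin n) B, v * star v = CStarMatrix.ofMatrix p ∧
        star v * v = CStarMatrix.ofMatrix q :=
    eventually_exists_mul_star_eq hp'
  filter_upwards [h] with q hq hq'
  exact hq ⟨hq'.1, hq'.2⟩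

theorem U.eventually_joined {n : ℕ} (u : U n B) : ∀ᶠ v in 𝓝 u, Joined u v := by
  let _ := CStarAlgebra.spectralOrder B
  have := CStarAlgebra.spectralOrderedRing B
  let u' : unitary (CStarMatrix (Fin n) (Fin n) B) := ⟨CStarMatrix.ofMatrix u.1, u.2⟩
  have h : ∀ᶠ v in 𝓝 u', Joined u' v := by
    filter_upwards [Metric.ball_mem_nhds u' zero_lt_two] with v hv
    refine Unitary.joined u' v ?_
    rwa [Metric.mem_ball, Subtype.dist_eq, dist_eq_norm] at hv
  exact h

end Perturbation

/-! ### Lifting along injective `*`-homomorphisms -/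

section Lifting

theorem exists_matrix_map_eq {B C : Type*} {f : B → C} {ι κ : Type*} {M : Matrix ι κ C}
    (hM : ∀ i j, M i j ∈ Set.range f) : ∃ N : Matrix ι κ B, N.map f = M := by
  choose N hN using hM
  exact ⟨Matrix.of N, by ext i j; exact hN i j⟩

variable {B C : Type*} [CStarAlgebra B] [CStarAlgebra C] {f : B →⋆ₐ[ℂ] C}

theorem isStarProjection_of_map (hf : Function.Injective f) {n : ℕ}
    {p : Matrix (Fin n) (Fin n) B} (hp : IsStarProjection (p.map f)) : IsStarProjection p := by
  have h1 : (p.map f)ᴴ = p.map f := hp.isSelfAdjoint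
  have h2 : p.map f * p.map f = p.map f := hp.isIdempotentElem
  refine ⟨Matrix.map_injective hf ?_, Matrix.map_injective hf ?_⟩
  · beta_reduce
    rw [Matrix.map_mul, h2]
  · change (pᴴ).map f = p.map f
    rw [conjTranspose_map f (fun x => map_star f x), h1]

theorem MatProj.exists_map_eq (hf : Function.Injective f) (p : MatProj C)
    (hp : ∀ i j, p.mat i j ∈ Set.range f) : ∃ p₀ : MatProj B, p₀.map f = p := by
  obtain ⟨n, p, h⟩ := p
  obtain ⟨N, rfl⟩ : ∃ N : Matrix (Fin n) (Fin n) B, N.map f = p := exists_matrix_map_eq hp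
  exact ⟨⟨n, N, isStarProjection_of_map hf h⟩, rfl⟩

theorem U.exists_map_eq (hf : Function.Injective f) {n : ℕ} (u : U n C)
    (hu : ∀ i j, u.1 i j ∈ Set.range f) : ∃ u₀ : U n B, U.map n f u₀ = u := by
  obtain ⟨u, h⟩ := u
  obtain ⟨N, rfl⟩ := exists_matrix_map_eq hu
  have h1 : (N.map f)ᴴ * N.map f = 1 := (Unitary.mem_iff.1 h).1
  have h2 : N.map f * (N.map f)ᴴ = 1 := (Unitary.mem_iff.1 h).2
  have e : (1 : Matrix (Fin n) (Fin n) B).map f = 1 :=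
    Matrix.map_one f (map_zero f) (map_one f)
  refine ⟨⟨N, Unitary.mem_iff.2 ⟨Matrix.map_injective hf ?_, Matrix.map_injective hf ?_⟩⟩, rfl⟩
  · change (Nᴴ * N).map f = (1 : Matrix (Fin n) (Fin n) B).map f
    rw [Matrix.map_mul, conjTranspose_map f (fun x => map_star f x), h1, e]
  · change (N * Nᴴ).map f = (1 : Matrix (Fin n) (Fin n) B).map f
    rw [Matrix.map_mul, conjTranspose_map f (fun x => map_star f x), h2, e]

theorem MvN.of_map (hf : Function.Injective f) {m n : ℕ} {p : Matrix (Fin m) (Fin m) B}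
    {q : Matrix (Fin n) (Fin n) B} {v : Matrix (Fin m) (Fin n) C}
    (hv : ∀ i j, v i j ∈ Set.range f) (h1 : v * vᴴ = p.map f) (h2 : vᴴ * v = q.map f) :
    MvN p q := by
  obtain ⟨v, rfl⟩ := exists_matrix_map_eq hv
  rw [← conjTranspose_map f (fun x => map_star f x), ← Matrix.map_mul] at h1 h2
  exact ⟨v, Matrix.map_injective hf h1, Matrix.map_injective hf h2⟩

/-- Injective `*`-homomorphisms of C*-algebras are isometric, so they are topological embeddings
entrywise. -/
theorem isInducing_matrix_map (hf : Function.Injective f) (m n : ℕ) :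
    IsInducing fun M : Matrix (Fin m) (Fin n) B => M.map f :=
  have hf' : IsInducing f := (AddMonoidHomClass.isometry_of_norm f
    (NonUnitalStarAlgHom.norm_map f hf)).isUniformInducing.isInducing
  IsInducing.piMap fun _ => IsInducing.piMap fun _ => hf'

theorem isClosed_range_of_injective (hf : Function.Injective f) : IsClosed (Set.range f) :=
  (AddMonoidHomClass.isometry_of_norm f
    (NonUnitalStarAlgHom.norm_map f hf)).isClosedEmbedding.isClosed_range

theorem U.isInducing_map (hf : Function.Injective f) (n : ℕ) : IsInducing (U.map n f) := by
  have h : IsInducing fun u : U n B => ((U.map n f u : U n C) : Matrix (Fin n) (Fin n) C) :=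
    (isInducing_matrix_map hf n n).comp IsInducing.subtypeVal
  exact IsInducing.of_comp (U.continuous_map n f) continuous_subtype_val h

end Lifting

/-! ### Countable witnesses for relations in `K`-theory -/

section Witness

/-- Equality in the Grothendieck group is stable equivalence of projections. -/
theorem K00.of_eq_of_iff {B : Type*} [Ring B] [StarRing B] {p q : MatProj B} :
    (Algebra.GrothendieckAddGroup.of (V.mk p) : K00 B) =
      Algebra.GrothendieckAddGroup.of (V.mk q) ↔
      ∃ r : MatProj B, MvN (r.sum p).mat (r.sum q).mat := by
  constructor
  · intro h
    obtain ⟨⟨r, _⟩, hr⟩ :=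
      (AddLocalization.addMonoidOf (⊤ : AddSubmonoid (V B))).eq_iff_exists.1 h
    obtain ⟨r, rfl⟩ := Quotient.exists_rep r
    exact ⟨r, Quotient.exact hr⟩
  · rintro ⟨r, hr⟩
    have h : V.mk r + V.mk p = V.mk r + V.mk q := V.mk_eq_of_mvN hr
    have := congrArg (Algebra.GrothendieckAddGroup.of (M := V B)) h
    simpa using this

theorem K00.exists_eq_sub {B : Type*} [Ring B] [StarRing B] (x : K00 B) :
    ∃ p q : MatProj B, x = Algebra.GrothendieckAddGroup.of (V.mk p) -
      Algebra.GrothendieckAddGroup.of (V.mk q) := by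
  obtain ⟨⟨⟨p⟩, ⟨⟨q⟩, hq⟩⟩, h⟩ := (AddLocalization.addMonoidOf (⊤ : AddSubmonoid (V B))).surj x
  exact ⟨p, q, eq_sub_of_add_eq h⟩

theorem MatProj.mat_sum_map {B C : Type*} [Ring B] [StarRing B] [Ring C] [StarRing C] [Algebra ℂ B]
    [Algebra ℂ C] (f : B →⋆ₐ[ℂ] C) (p q : MatProj B) :
    (p.sum q).mat.map f = ((p.map f).sum (q.map f)).mat := by
  change ((fromBlocks p.mat 0 0 q.mat).submatrix finSumFinEquiv.symm finSumFinEquiv.symm).map f =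
    (fromBlocks (p.mat.map f) 0 0 (q.mat.map f)).submatrix finSumFinEquiv.symm finSumFinEquiv.symm
  rw [← submatrix_map, fromBlocks_map, Matrix.map_zero f (map_zero f),
    Matrix.map_zero f (map_zero f)]

/-- If `[p] = [q]` in `K₀(C)`, this is seen by finitely many elements of `C`, namely the entries of
a projection `r` and of a partial isometry from `r ⊕ p` to `r ⊕ q`. The equality therefore holds
already in any subalgebra containing these entries together with those of `p` and `q`. -/
theorem K00.exists_countable_witness {C : Type u} [CStarAlgebra C] (p q : MatProj C) :
    ∃ T : Set C, T.Countable ∧ ∀ (B : Type u) [CStarAlgebra B] (f : B →⋆ₐ[ℂ] C),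
      Function.Injective f → T ⊆ Set.range f → ∀ p₀ q₀ : MatProj B, p₀.map f = p → q₀.map f = q →
      (Algebra.GrothendieckAddGroup.of (V.mk p) : K00 C) =
        Algebra.GrothendieckAddGroup.of (V.mk q) →
      (Algebra.GrothendieckAddGroup.of (V.mk p₀) : K00 B) =
        Algebra.GrothendieckAddGroup.of (V.mk q₀) := by
  by_cases h : (Algebra.GrothendieckAddGroup.of (V.mk p) : K00 C) =
      Algebra.GrothendieckAddGroup.of (V.mk q)
  · obtain ⟨r, v, h1, h2⟩ := K00.of_eq_of_iff.1 h
    refine ⟨(Set.range fun i : _ × _ => r.mat i.1 i.2) ∪ Set.range fun i : _ × _ => v i.1 i.2,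
      (Set.countable_range _).union (Set.countable_range _), ?_⟩
    rintro B _ f hf hT p₀ q₀ rfl rfl -
    obtain ⟨r, rfl⟩ := MatProj.exists_map_eq hf r fun i j => hT (.inl ⟨(i, j), rfl⟩)
    exact K00.of_eq_of_iff.2
      ⟨r, MvN.of_map (p := (r.sum p₀).mat) (q := (r.sum q₀).mat) hf
        (fun i j => hT (.inr ⟨(i, j), rfl⟩)) (h1.trans (MatProj.mat_sum_map f r p₀).symm)
        (h2.trans (MatProj.mat_sum_map f r q₀).symm)⟩
  · exact ⟨∅, Set.countable_empty, fun _ _ _ _ _ _ _ _ _ h' => absurd h' h⟩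

/-- The class in `K₁` of a unitary matrix. -/
def K11.mk {B : Type*} [CStarAlgebra B] {n : ℕ} (u : U n B) : K11 B := ⟦⟨n, QuotientGroup.mk u⟩⟧

theorem K11.exists_eq_mk {B : Type*} [CStarAlgebra B] (x : K11 B) :
    ∃ (n : ℕ) (u : U n B), x = K11.mk u := by
  obtain ⟨n, ⟨u⟩⟩ := x
  exact ⟨n, u, rfl⟩

theorem K11.mk_eq_one_iff {B : Type*} [CStarAlgebra B] {n : ℕ} {u : U n B} :
    K11.mk u = 1 ↔ ∃ (m : ℕ) (h : n ≤ m), Joined 1 (U.pad h u) := by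
  refine (DirectLimit.exists_eq_one _).trans (exists_congr fun m => exists_congr fun h => ?_)
  exact QuotientGroup.eq_one_iff (N := Subgroup.pathComponentOne (U m B)) (U.pad h u)

theorem K11.mk_eq_of_joined {B : Type*} [CStarAlgebra B] {n : ℕ} {u v : U n B}
    (h : Joined u v) : K11.mk u = K11.mk v := by
  have h' : (QuotientGroup.mk u : PiZeroU n B) = QuotientGroup.mk v := by
    refine QuotientGroup.eq.2 ?_
    have : Joined (u⁻¹ * u) (u⁻¹ * v) := h.map (continuous_const_mul u⁻¹)
    rwa [inv_mul_cancel] at this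
  exact congrArg (fun x : PiZeroU n B => (⟦⟨n, x⟩⟧ : K11 B)) h'

theorem U.map_pad {B C : Type*} [CStarAlgebra B] [CStarAlgebra C] (f : B →⋆ₐ[ℂ] C) {n m : ℕ}
    (h : n ≤ m) (u : U n B) : U.map m f (U.pad h u) = U.pad h (U.map n f u) := by
  refine Subtype.ext ?_
  change Matrix.map (CStarKTheory.pad m u.1) f = CStarKTheory.pad m (Matrix.map u.1 f)
  ext i j
  simp only [CStarKTheory.pad, of_apply, Matrix.map_apply]
  split_ifs <;> simp

theorem U.map_injective {B C : Type*} [CStarAlgebra B] [CStarAlgebra C] {f : B →⋆ₐ[ℂ] C}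
    (hf : Function.Injective f) (n : ℕ) : Function.Injective (U.map n f) := fun _ _ h =>
  Subtype.ext (Matrix.map_injective hf (congrArg Subtype.val h))

/-- If `[u] = 1` in `K₁(C)`, then some `u ⊕ 1` is joined to `1` by a path of unitaries. The entries of
the path at a countable dense set of times generate a closed subalgebra containing all entries of
the path, so `[u] = 1` already in any such subalgebra over which `u` is defined. -/
theorem K11.exists_countable_witness {C : Type u} [CStarAlgebra C] {n : ℕ} (u : U n C) :
    ∃ T : Set C, T.Countable ∧ ∀ (B : Type u) [CStarAlgebra B] (f : B →⋆ₐ[ℂ] C),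
      Function.Injective f → T ⊆ Set.range f → ∀ u₀ : U n B, U.map n f u₀ = u →
      K11.mk u = 1 → K11.mk u₀ = 1 := by
  by_cases h : K11.mk u = 1
  · obtain ⟨m, hm, ⟨γ⟩⟩ := K11.mk_eq_one_iff.1 h
    refine ⟨Set.range fun x : ℕ × Fin m × Fin m =>
      (γ (denseSeq unitInterval x.1)).1 x.2.1 x.2.2, Set.countable_range _, ?_⟩
    rintro B _ f hf hT u₀ rfl -
    have hγ : ∀ t i j, (γ t).1 i j ∈ Set.range f := by
      intro t i j
      have hc : Continuous fun t => (γ t).1 i j :=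
        (continuous_subtype_val.comp γ.continuous).matrix_elem i j
      have hs : IsClosed {t | (γ t).1 i j ∈ Set.range f} :=
        (isClosed_range_of_injective hf).preimage hc
      have hd : closure (Set.range (denseSeq unitInterval)) ⊆ {t | (γ t).1 i j ∈ Set.range f} := by
        refine closure_minimal ?_ hs
        rintro _ ⟨k, rfl⟩
        exact hT ⟨(k, i, j), rfl⟩
      exact hd (denseRange_denseSeq unitInterval t)
    choose δ hδ using fun t => U.exists_map_eq hf (γ t) (hγ t)
    refine K11.mk_eq_one_iff.2 ⟨m, hm, ⟨⟨⟨δ, ?_⟩, ?_, ?_⟩⟩⟩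
    · rw [(U.isInducing_map hf m).continuous_iff]
      exact γ.continuous.congr fun t => (hδ t).symm
    · exact U.map_injective hf m ((hδ 0).trans (γ.source.trans (map_one _).symm))
    · exact U.map_injective hf m ((hδ 1).trans (γ.target.trans (U.map_pad f hm u₀).symm))
  · exact ⟨∅, Set.countable_empty, fun _ _ _ _ _ _ _ h' => absurd h' h⟩

end Witness

/-! ### Approximation from a separable set -/

section Density

/-- Points of a separable set `Y` are approximated by a suitable countable subset `D` of `P` as well
as they are by `P` itself, although `P` need not be separable. -/
theorem exists_countable_approx {X : Type*} [PseudoMetricSpace X] (P : Set X) {Y : Set X}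
    (hY : IsSeparable Y) : ∃ D ⊆ P, D.Countable ∧
      ∀ y ∈ Y, ∀ p ∈ P, ∀ ε, dist y p < ε → ∃ d ∈ D, dist y d < ε := by
  obtain ⟨Q, hQ, hYQ⟩ := hY
  have h : ∀ x : X × ℚ, ∃ D ⊆ P, D.Countable ∧
      ((∃ p ∈ P, dist x.1 p < x.2) → ∃ d ∈ D, dist x.1 d < x.2) := by
    intro x
    by_cases hx : ∃ p ∈ P, dist x.1 p < x.2
    · obtain ⟨p, hp, hxp⟩ := hx
      exact ⟨{p}, by simpa, Set.countable_singleton p, fun _ => ⟨p, rfl, hxp⟩⟩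
    · exact ⟨∅, by simp, Set.countable_empty, fun h => absurd h hx⟩
  choose D hDP hDc hD using h
  refine ⟨⋃ x ∈ Q ×ˢ Set.univ, D x, by simp [hDP],
    (hQ.prod Set.countable_univ).biUnion fun x _ => hDc x, ?_⟩
  intro y hy p hp ε hε
  obtain ⟨x, hxQ, hxy⟩ := Metric.mem_closure_iff.1 (hYQ hy) ((ε - dist y p) / 2) (by linarith)
  -- A rational radius about `x` that reaches `p` and still keeps the ball inside that of radius `ε`
  -- about `y`.
  obtain ⟨q, hq1, hq2⟩ : ∃ q : ℚ, dist y p + (ε - dist y p) / 2 < q ∧ (q : ℝ) < ε - dist y x :=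
    exists_rat_btwn (by linarith)
  obtain ⟨d, hd, hxd⟩ := hD (x, q) ⟨p, hp, by
    have := dist_triangle_left x p y
    dsimp only
    linarith⟩
  refine ⟨d, Set.mem_biUnion (x := (x, q)) ⟨hxQ, Set.mem_univ _⟩ hd, ?_⟩
  have := dist_triangle y x d
  dsimp only at hxd
  linarith

end Density

/-! ### Separable subalgebras and their enlargements -/

section Subalgebra

variable {A : Type u} [NonUnitalCStarAlgebra A]

theorem isSeparable_adjoin {s : Set A} (hs : s.Countable) :
    IsSeparable (NonUnitalStarAlgebra.adjoin ℂ s : Set A) := by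
  have hc : (Subsemigroup.closure (s ∪ star s) : Set A).Countable := by
    have hst : (s ∪ star s).Countable := hs.union (hs.preimage star_injective)
    -- The closure under products of a countable set is exhausted by the countable sets obtained by
    -- repeatedly adjoining all products of two elements.
    let g : ℕ → Set A := fun n => Nat.rec (s ∪ star s) (fun _ t => t ∪ t * t) n
    have hg : ∀ n, (g n).Countable := by
      intro n
      induction n with
      | zero => exact hst
      | succ n ih => exact ih.union (Set.Countable.image2 ih ih _)
    have hmono : Monotone g := monotone_nat_of_le_succ fun n => Set.subset_union_left
    let S : Subsemigroup A :=
      { carrier := ⋃ n, g n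
        mul_mem' := by
          intro a b ha hb
          obtain ⟨m, hm⟩ := Set.mem_iUnion.1 ha
          obtain ⟨n, hn⟩ := Set.mem_iUnion.1 hb
          exact Set.mem_iUnion.2 ⟨max m n + 1, .inr (Set.mul_mem_mul
            (hmono (le_max_left m n) hm) (hmono (le_max_right m n) hn))⟩ }
    have hS : Subsemigroup.closure (s ∪ star s) ≤ S :=
      Subsemigroup.closure_le.2 (Set.subset_iUnion g 0)
    exact (Set.countable_iUnion hg).mono hS
  have h := NonUnitalStarAlgebra.adjoin_eq_span (R := ℂ) s
  have h' : (NonUnitalStarAlgebra.adjoin ℂ s : Set A) =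
      Submodule.span ℂ (Subsemigroup.closure (s ∪ star s) : Set A) :=
    congrArg (fun N : Submodule ℂ A => (N : Set A)) h
  rw [h']
  exact hc.isSeparable.span

theorem exists_separable_subalgebra {s : Set A} (hs : IsSeparable s) :
    ∃ F : NonUnitalStarSubalgebra ℂ A, IsClosed (F : Set A) ∧ IsSeparable (F : Set A) ∧ s ⊆ F := by
  obtain ⟨c, hc, hsc⟩ := hs
  refine ⟨(NonUnitalStarAlgebra.adjoin ℂ c).topologicalClosure,
    NonUnitalStarSubalgebra.isClosed_topologicalClosure _, (isSeparable_adjoin hc).closure,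
    hsc.trans (closure_mono (NonUnitalStarAlgebra.subset_adjoin ℂ c))⟩

/-- The inclusion `θ⁺ → A⁺` of unitizations. -/
abbrev inclusionUnitization (θ : NonUnitalStarSubalgebra ℂ A) :
    Unitization ℂ θ →⋆ₐ[ℂ] Unitization ℂ A :=
  Unitization.starMap (NonUnitalStarSubalgebraClass.subtype (R := ℂ) θ)

theorem inclusionUnitization_injective (θ : NonUnitalStarSubalgebra ℂ A) :
    Function.Injective (inclusionUnitization θ) :=
  Unitization.starMap_injective Subtype.val_injective

theorem mem_range_inclusionUnitization {θ : NonUnitalStarSubalgebra ℂ A} {x : Unitization ℂ A} :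
    x ∈ Set.range (inclusionUnitization θ) ↔ x.snd ∈ θ := by
  constructor
  · rintro ⟨y, rfl⟩
    simp [inclusionUnitization, Unitization.algebraMap_eq_inl]
  · intro hx
    refine ⟨Unitization.inl x.fst + Unitization.inr ⟨x.snd, hx⟩, ?_⟩
    ext <;> simp [inclusionUnitization, Unitization.algebraMap_eq_inl]

/-- The matrices of size `n` over `A⁺` whose entries lie in `F⁺`, as functions of two indices. -/
def matricesOver (F : NonUnitalStarSubalgebra ℂ A) (n : ℕ) :
    Set (Fin n → Fin n → Unitization ℂ A) :=
  {M | ∀ i j, (M i j).snd ∈ F}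

theorem isSeparable_matricesOver {F : NonUnitalStarSubalgebra ℂ A} (hF : IsSeparable (F : Set A))
    (n : ℕ) : IsSeparable (matricesOver F n) := by
  have h1 : IsSeparable {x : Unitization ℂ A | x.snd ∈ F} := by
    have hc : Continuous fun x : ℂ × A => (Unitization.inl x.1 + Unitization.inr x.2 :
        Unitization ℂ A) := by
      have h : Continuous (Unitization.inl : ℂ → Unitization ℂ A) :=
        continuous_algebraMap ℂ (Unitization ℂ A)
      exact (h.comp continuous_fst).add (Unitization.continuous_inr.comp continuous_snd)
    refine (((isSeparable_univ_iff.2 inferInstance : IsSeparable (Set.univ : Set ℂ)).prod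
      hF).image hc).mono ?_
    intro x hx
    exact ⟨(x.fst, x.snd), ⟨Set.mem_univ _, hx⟩, Unitization.inl_fst_add_inr_snd_eq x⟩
  have h2 := isSeparable_pi (ι := Fin n) fun _ => isSeparable_pi (ι := Fin n) fun _ => h1
  exact h2

theorem eventually_exists_matricesOver_dist_lt {F : ℕ → NonUnitalStarSubalgebra ℂ A}
    (hF : Monotone F) {n : ℕ} {M : Fin n → Fin n → Unitization ℂ A}
    (hM : ∀ i j, (M i j).snd ∈ closure (⋃ k, (F k : Set A))) {ε : ℝ} (hε : 0 < ε) :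
    ∀ᶠ k in atTop, ∃ N ∈ matricesOver (F k) n, dist N M < ε := by
  have h : ∀ i j, ∀ᶠ k in atTop, ∃ a ∈ F k, dist a (M i j).snd < ε := by
    intro i j
    obtain ⟨a, ha, hd⟩ := Metric.mem_closure_iff.1 (hM i j) ε hε
    obtain ⟨k, hk⟩ := Set.mem_iUnion.1 ha
    filter_upwards [eventually_ge_atTop k] with l hl
    exact ⟨a, hF hl hk, by rwa [dist_comm]⟩
  filter_upwards [eventually_all.2 fun i => eventually_all.2 fun j => h i j] with k hk
  choose a ha hd using hk
  refine ⟨fun i j => Unitization.inl (M i j).fst + Unitization.inr (a i j),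
    fun i j => by simpa using ha i j, ?_⟩
  refine (dist_pi_lt_iff hε).2 fun i => (dist_pi_lt_iff hε).2 fun j => ?_
  have e : Unitization.inl (M i j).fst + Unitization.inr (a i j) - M i j =
      (Unitization.inr (a i j - (M i j).snd) : Unitization ℂ A) := by
    ext <;> simp [sub_eq_add_neg]
  rw [dist_eq_norm, e, Unitization.norm_inr, ← dist_eq_norm]
  exact hd i j

/-- `F'` enlarges `F`, as witnessed by the families `D` of projections and `E` of unitaries in
matrices over `A⁺`. The members of `D` and `E` are defined over `F'⁺`; they approximate points of
`M_n(F⁺)` as well as arbitrary projections and unitaries over `A⁺` do; and a relation `[p] = [q]`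
or `[u] = 1` in the `K`-theory of `A⁺` between members of `D` and `E` holds in the `K`-theory of
`θ⁺` for every closed `θ` containing `F'`. Distances are those of `Fin n → Fin n → A⁺`, since
`Matrix` carries no global metric. -/
structure IsEnlargement (F F' : NonUnitalStarSubalgebra ℂ A) (D : Set (MatProj (Unitization ℂ A)))
    (E : ∀ n, Set (U n (Unitization ℂ A))) : Prop where
  le : F ≤ F'
  proj_mem : ∀ p ∈ D, ∀ i j, (p.mat i j).snd ∈ F'
  unitary_mem : ∀ n, ∀ u ∈ E n, ∀ i j, (u.1 i j).snd ∈ F'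
  proj_approx : ∀ p : MatProj (Unitization ℂ A), ∀ M ∈ matricesOver F p.size, ∀ ε : ℝ,
    dist M p.mat < ε → ∃ (q : Matrix (Fin p.size) (Fin p.size) (Unitization ℂ A))
      (hq : IsStarProjection q), ⟨p.size, q, hq⟩ ∈ D ∧ dist (α := Fin _ → Fin _ → _) M q < ε
  unitary_approx : ∀ n, ∀ u : U n (Unitization ℂ A), ∀ M ∈ matricesOver F n, ∀ ε : ℝ,
    dist M u.1 < ε → ∃ v ∈ E n, dist (α := Fin _ → Fin _ → _) M v.1 < ε
  proj_eq : ∀ p ∈ D, ∀ q ∈ D, (Algebra.GrothendieckAddGroup.of (V.mk p) : K00 (Unitization ℂ A)) =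
    Algebra.GrothendieckAddGroup.of (V.mk q) → ∀ (θ : NonUnitalStarSubalgebra ℂ A)
    [IsClosed (θ : Set A)], F' ≤ θ → ∀ p₀ q₀ : MatProj (Unitization ℂ θ),
    p₀.map (inclusionUnitization θ) = p → q₀.map (inclusionUnitization θ) = q →
    (Algebra.GrothendieckAddGroup.of (V.mk p₀) : K00 (Unitization ℂ θ)) =
      Algebra.GrothendieckAddGroup.of (V.mk q₀)
  unitary_eq : ∀ n, ∀ u ∈ E n, K11.mk u = 1 → ∀ (θ : NonUnitalStarSubalgebra ℂ A)
    [IsClosed (θ : Set A)], F' ≤ θ → ∀ u₀ : U n (Unitization ℂ θ),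
    U.map n (inclusionUnitization θ) u₀ = u → K11.mk u₀ = 1

/-- Since `F` is separable, `D` and `E` can be chosen countable, so countably many elements of `A`
must be added to `F`: the components of the entries of `D` and `E`, and the witnesses for the
relations among them. -/
theorem exists_isEnlargement {F : NonUnitalStarSubalgebra ℂ A} (hF : IsSeparable (F : Set A)) :
    ∃ F' : NonUnitalStarSubalgebra ℂ A, IsClosed (F' : Set A) ∧ IsSeparable (F' : Set A) ∧
      ∃ D E, IsEnlargement F F' D E := by
  have hD := fun n => exists_countable_approx (X := Fin n → Fin n → Unitization ℂ A)
    {M | IsStarProjection (R := Matrix (Fin n) (Fin n) (Unitization ℂ A)) M}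
    (isSeparable_matricesOver hF n)
  have hE := fun n => exists_countable_approx (X := Fin n → Fin n → Unitization ℂ A)
    {M | M ∈ unitary (Matrix (Fin n) (Fin n) (Unitization ℂ A))}
    (isSeparable_matricesOver hF n)
  choose D₀ hD₀P hD₀c hD₀ using hD
  choose E₀ hE₀P hE₀c hE₀ using hE
  let D : Set (MatProj (Unitization ℂ A)) := {p | p.mat ∈ D₀ p.size}
  let E : ∀ n, Set (U n (Unitization ℂ A)) := fun n => Subtype.val ⁻¹' E₀ n
  have hDc : D.Countable := by
    have : D ⊆ ⋃ n, Set.range fun x : D₀ n => (⟨n, x.1, hD₀P n x.2⟩ : MatProj _) := by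
      rintro ⟨n, p, h⟩ hp
      exact Set.mem_iUnion.2 ⟨n, ⟨p, hp⟩, rfl⟩
    have hc : ∀ n, Countable (D₀ n) := fun n => (hD₀c n).to_subtype
    exact (Set.countable_iUnion fun n => Set.countable_range _).mono this
  have hEc : ∀ n, (E n).Countable := fun n => (hE₀c n).preimage Subtype.val_injective
  choose T hTc hT using fun x : MatProj (Unitization ℂ A) × MatProj (Unitization ℂ A) =>
    K00.exists_countable_witness x.1 x.2
  choose S hSc hS using fun x : Σ n, U n (Unitization ℂ A) => K11.exists_countable_witness x.2
  let G : Set (Unitization ℂ A) :=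
    ((⋃ p ∈ D, Set.range fun x : Fin p.size × Fin p.size => p.mat x.1 x.2) ∪
      (⋃ n, ⋃ u ∈ E n, Set.range fun x : Fin n × Fin n => u.1 x.1 x.2)) ∪
    ((⋃ x ∈ D ×ˢ D, T x) ∪ (⋃ n, ⋃ u ∈ E n, S ⟨n, u⟩))
  have hG : G.Countable :=
    ((hDc.biUnion fun p _ => Set.countable_range _).union
      (Set.countable_iUnion fun n => (hEc n).biUnion fun u _ => Set.countable_range _)).union
    (((hDc.prod hDc).biUnion fun x _ => hTc x).union
      (Set.countable_iUnion fun n => (hEc n).biUnion fun u _ => hSc _))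
  obtain ⟨F', hF'c, hF's, hF'⟩ := exists_separable_subalgebra
    (hF.union (hG.image fun x => x.snd).isSeparable)
  have hGF : ∀ x ∈ G, x.snd ∈ F' := fun x hx => hF' (.inr ⟨x, hx, rfl⟩)
  refine ⟨F', hF'c, hF's, D, E, ?_, ?_, ?_, ?_, ?_, ?_, ?_⟩
  · exact fun x hx => hF' (.inl hx)
  · exact fun p hp i j => hGF _ (.inl (.inl (Set.mem_biUnion hp ⟨(i, j), rfl⟩)))
  · exact fun n u hu i j => hGF _ (.inl (.inr (Set.mem_iUnion.2
      ⟨n, Set.mem_biUnion hu ⟨(i, j), rfl⟩⟩)))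
  · intro p M hM ε hε
    obtain ⟨q, hq, hd⟩ := hD₀ p.size M hM p.mat p.isProj ε hε
    exact ⟨q, hD₀P _ hq, hq, hd⟩
  · intro n u M hM ε hε
    obtain ⟨q, hq, hd⟩ := hE₀ n M hM u.1 u.2 ε hε
    exact ⟨⟨q, hE₀P _ hq⟩, hq, hd⟩
  · intro p hp q hq h θ _ hθ p₀ q₀ hp₀ hq₀
    refine hT (p, q) _ (inclusionUnitization θ) (inclusionUnitization_injective θ) ?_ p₀ q₀ hp₀
      hq₀ h
    exact fun x hx => mem_range_inclusionUnitization.2 (hθ (hGF _ (.inr (.inl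
      (Set.mem_biUnion (x := (p, q)) ⟨hp, hq⟩ hx)))))
  · intro n u hu h θ _ hθ u₀ hu₀
    refine hS ⟨n, u⟩ _ (inclusionUnitization θ) (inclusionUnitization_injective θ) ?_ u₀ hu₀ h
    exact fun x hx => mem_range_inclusionUnitization.2 (hθ (hGF _ (.inr (.inr
      (Set.mem_iUnion.2 ⟨n, Set.mem_biUnion hu hx⟩)))))

end Subalgebra

/-! ### Classes over the closure of an increasing union -/

section Injectivity

variable {A : Type u} [NonUnitalCStarAlgebra A] {F : ℕ → NonUnitalStarSubalgebra ℂ A}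
  {D : ℕ → Set (MatProj (Unitization ℂ A))} {E : ℕ → ∀ n, Set (U n (Unitization ℂ A))}
  {θ : NonUnitalStarSubalgebra ℂ A}

theorem le_of_coe_eq_closure (hθ : (θ : Set A) = closure (⋃ n, (F n : Set A))) (k : ℕ) :
    F k ≤ θ := by
  rw [← SetLike.coe_subset_coe, hθ]
  exact (Set.subset_iUnion (fun n => (F n : Set A)) k).trans subset_closure

/-- A projection over `θ⁺` is close to a matrix over some `F k⁺`, hence to a member of `D k`, to which
it is equivalent over `θ⁺`. That this holds for all large `k` allows two projections to be treated
with the same `k`. -/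
theorem eventually_exists_projection_class_eq (hF : Monotone F)
    (h : ∀ k, IsEnlargement (F k) (F (k + 1)) (D k) (E k)) [IsClosed (θ : Set A)]
    (hθ : (θ : Set A) = closure (⋃ n, (F n : Set A))) (p : MatProj (Unitization ℂ θ)) :
    ∀ᶠ k in atTop, ∃ q : MatProj (Unitization ℂ θ), q.map (inclusionUnitization θ) ∈ D k ∧
      V.mk p = V.mk q := by
  have hFθ := le_of_coe_eq_closure hθ
  have hi := inclusionUnitization_injective θ
  have hp := MvN.eventually p.isProj
  rw [(isInducing_matrix_map hi p.size p.size).nhds_eq_comap, eventually_comap] at hp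
  obtain ⟨ε, hε, hball⟩ := Metric.eventually_nhds_iff.1
    (show ∀ᶠ M : Fin p.size → Fin p.size → Unitization ℂ A in
      𝓝 (p.map (inclusionUnitization θ)).mat, _ from hp)
  have hmem : ∀ i j, ((p.map (inclusionUnitization θ)).mat i j).snd ∈
      closure (⋃ k, (F k : Set A)) := fun i j => by
    rw [← hθ]
    exact mem_range_inclusionUnitization.1 ⟨p.mat i j, rfl⟩
  filter_upwards [eventually_exists_matricesOver_dist_lt hF hmem (half_pos hε)] with k hk
  obtain ⟨M, hM, hd⟩ := hk
  obtain ⟨q, hq, hqD, hMq⟩ := (h k).proj_approx (p.map (inclusionUnitization θ)) M hM _ hd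
  have hdist : dist (α := Fin p.size → Fin p.size → Unitization ℂ A) q
      (p.map (inclusionUnitization θ)).mat < ε := by
    refine (dist_triangle_left (α := Fin p.size → Fin p.size → Unitization ℂ A) q
      (p.map (inclusionUnitization θ)).mat M).trans_lt ?_
    rw [← add_halves ε]
    exact add_lt_add hMq hd
  obtain ⟨N, hN⟩ := exists_matrix_map_eq (f := inclusionUnitization θ) (M := q) fun i j =>
    mem_range_inclusionUnitization.2 (hFθ (k + 1) ((h k).proj_mem _ hqD i j))
  have hNp : IsStarProjection N := isStarProjection_of_map hi (hN ▸ hq)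
  refine ⟨⟨p.size, N, hNp⟩, ?_, V.mk_eq_of_mvN (hball hdist N hN hNp)⟩
  subst hN
  exact hqD

/-- A unitary over `θ⁺` is close to a matrix over some `F k⁺`, hence to a member of `E k n`, to which
it is joined by a path of unitaries over `θ⁺`. -/
theorem eventually_exists_unitary_class_eq (hF : Monotone F)
    (h : ∀ k, IsEnlargement (F k) (F (k + 1)) (D k) (E k)) [IsClosed (θ : Set A)]
    (hθ : (θ : Set A) = closure (⋃ n, (F n : Set A))) {n : ℕ} (u : U n (Unitization ℂ θ)) :
    ∀ᶠ k in atTop, ∃ v : U n (Unitization ℂ θ), U.map n (inclusionUnitization θ) v ∈ E k n ∧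
      K11.mk u = K11.mk v := by
  have hFθ := le_of_coe_eq_closure hθ
  have hi := inclusionUnitization_injective θ
  have hu := U.eventually_joined u
  rw [((isInducing_matrix_map hi n n).comp IsInducing.subtypeVal).nhds_eq_comap,
    eventually_comap] at hu
  obtain ⟨ε, hε, hball⟩ := Metric.eventually_nhds_iff.1
    (show ∀ᶠ M : Fin n → Fin n → Unitization ℂ A in
      𝓝 (U.map n (inclusionUnitization θ) u).1, _ from hu)
  have hmem : ∀ i j, ((U.map n (inclusionUnitization θ) u).1 i j).snd ∈
      closure (⋃ k, (F k : Set A)) := fun i j => by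
    rw [← hθ]
    exact mem_range_inclusionUnitization.1 ⟨u.1 i j, rfl⟩
  filter_upwards [eventually_exists_matricesOver_dist_lt hF hmem (half_pos hε)] with k hk
  obtain ⟨M, hM, hd⟩ := hk
  obtain ⟨v, hvE, hMv⟩ := (h k).unitary_approx n (U.map n (inclusionUnitization θ) u) M hM _ hd
  have hdist : dist (α := Fin n → Fin n → Unitization ℂ A) v.1
      (U.map n (inclusionUnitization θ) u).1 < ε := by
    refine (dist_triangle_left (α := Fin n → Fin n → Unitization ℂ A) v.1
      (U.map n (inclusionUnitization θ) u).1 M).trans_lt ?_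
    rw [← add_halves ε]
    exact add_lt_add hMv hd
  obtain ⟨w, rfl⟩ := U.exists_map_eq hi v fun i j =>
    mem_range_inclusionUnitization.2 (hFθ (k + 1) ((h k).unitary_mem n _ hvE i j))
  exact ⟨w, hvE, K11.mk_eq_of_joined (hball hdist w rfl)⟩

end Injectivity

variable {A : Type u} [NonUnitalCStarAlgebra A]

/-! ### The induced map on `K_*` -/

section Surjectivity

/-- A class `[p] - [q]` in `K₀(A)` comes from any closed subalgebra containing the `A`-components of
the entries of `p` and `q`. -/
theorem K0.exists_countable_mem_range (x : K0 A) :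
    ∃ T : Set A, T.Countable ∧ ∀ (θ : NonUnitalStarSubalgebra ℂ A) [IsClosed (θ : Set A)],
      T ⊆ θ → x ∈ Set.range (K0.map (NonUnitalStarSubalgebraClass.subtype (R := ℂ) θ)) := by
  obtain ⟨x, hx⟩ := x
  obtain ⟨p, q, rfl⟩ := K00.exists_eq_sub x
  refine ⟨(Set.range fun i : _ × _ => (p.mat i.1 i.2).snd) ∪
    Set.range fun i : _ × _ => (q.mat i.1 i.2).snd,
    (Set.countable_range _).union (Set.countable_range _), fun θ _ hT => ?_⟩
  have hi := inclusionUnitization_injective θ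
  obtain ⟨p, rfl⟩ := p.exists_map_eq hi fun i j =>
    mem_range_inclusionUnitization.2 (hT (.inl ⟨(i, j), rfl⟩))
  obtain ⟨q, rfl⟩ := q.exists_map_eq hi fun i j =>
    mem_range_inclusionUnitization.2 (hT (.inr ⟨(i, j), rfl⟩))
  have hmap : K00.map (inclusionUnitization θ) (Algebra.GrothendieckAddGroup.of (V.mk p) -
      Algebra.GrothendieckAddGroup.of (V.mk q)) =
      Algebra.GrothendieckAddGroup.of (V.mk (p.map (inclusionUnitization θ))) -
        Algebra.GrothendieckAddGroup.of (V.mk (q.map (inclusionUnitization θ))) := by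
    rw [map_sub, K00.map_of, K00.map_of]
    rfl
  -- Both scalar homomorphisms agree on `θ⁺`, so the lifted difference lies in `K₀(θ)` rather than
  -- only in `K₀(θ⁺)`.
  have hs : (scalarHom A).comp (inclusionUnitization θ) = scalarHom θ := by
    ext a
    change (inclusionUnitization θ (a : Unitization ℂ θ)).fst = (a : Unitization ℂ θ).fst
    simp [inclusionUnitization]
  refine ⟨⟨Algebra.GrothendieckAddGroup.of (V.mk p) - Algebra.GrothendieckAddGroup.of (V.mk q), ?_⟩,
    Subtype.ext hmap⟩
  change K00.map (scalarHom θ) _ = 0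
  rw [← hs, K00.map_comp, AddMonoidHom.comp_apply, hmap]
  exact hx

/-- The class of `u` in `K₁(A)` comes from any closed subalgebra containing the `A`-components of the
entries of `u`. -/
theorem K1.exists_countable_mem_range (x : K1 A) :
    ∃ T : Set A, T.Countable ∧ ∀ (θ : NonUnitalStarSubalgebra ℂ A) [IsClosed (θ : Set A)],
      T ⊆ θ → x ∈ Set.range (K1.map (NonUnitalStarSubalgebraClass.subtype (R := ℂ) θ)) := by
  obtain ⟨n, u, rfl⟩ := K11.exists_eq_mk x
  refine ⟨Set.range fun i : _ × _ => (u.1 i.1 i.2).snd, Set.countable_range _, fun θ _ hT => ?_⟩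
  obtain ⟨u, rfl⟩ := U.exists_map_eq (inclusionUnitization_injective θ) u fun i j =>
    mem_range_inclusionUnitization.2 (hT ⟨(i, j), rfl⟩)
  exact ⟨K11.mk u, rfl⟩

theorem KStar.exists_countable_surjective (hA : Countable (KStar A)) :
    ∃ T : Set A, T.Countable ∧ ∀ (θ : NonUnitalStarSubalgebra ℂ A) [IsClosed (θ : Set A)],
      T ⊆ θ → Function.Surjective
        (KStar.map (NonUnitalStarSubalgebraClass.subtype (R := ℂ) θ)) := by
  choose T₀ hT₀c hT₀ using fun x : KStar A => K0.exists_countable_mem_range x.1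
  choose T₁ hT₁c hT₁ using fun x : KStar A => K1.exists_countable_mem_range x.2.toMul
  refine ⟨⋃ x, T₀ x ∪ T₁ x, Set.countable_iUnion fun x => (hT₀c x).union (hT₁c x),
    fun θ _ hT x => ?_⟩
  have hx := (Set.subset_iUnion (fun x => T₀ x ∪ T₁ x) x).trans hT
  obtain ⟨y, hy⟩ := hT₀ x θ (Set.subset_union_left.trans hx)
  obtain ⟨z, hz⟩ := hT₁ x θ (Set.subset_union_right.trans hx)
  exact ⟨(y, Additive.ofMul z), Prod.ext hy (congrArg Additive.ofMul hz)⟩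

end Surjectivity

/-- Over the closure `θ` of the union of a sequence of enlargements, all classes are represented by
members of the families `D` and `E`, and relations among those that hold over `A` hold over `θ`. -/
theorem KStar.map_injective {F : ℕ → NonUnitalStarSubalgebra ℂ A}
    {D : ℕ → Set (MatProj (Unitization ℂ A))} {E : ℕ → ∀ n, Set (U n (Unitization ℂ A))}
    {θ : NonUnitalStarSubalgebra ℂ A} (hF : Monotone F)
    (h : ∀ k, IsEnlargement (F k) (F (k + 1)) (D k) (E k)) [IsClosed (θ : Set A)]
    (hθ : (θ : Set A) = closure (⋃ n, (F n : Set A))) :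
    Function.Injective (KStar.map (NonUnitalStarSubalgebraClass.subtype (R := ℂ) θ)) := by
  have hFθ : ∀ k, F k ≤ θ := fun k => le_of_coe_eq_closure hθ k
  refine (injective_iff_map_eq_zero _).2 ?_
  rintro ⟨⟨x, hx⟩, y⟩ hxy
  have hx0 : K00.map (inclusionUnitization θ) x = 0 :=
    congrArg (fun z : KStar A => (z.1 : K00 (Unitization ℂ A))) hxy
  have hy0 : K11.map (inclusionUnitization θ) y.toMul = 1 :=
    congrArg (fun z : KStar A => z.2.toMul) hxy
  have hx1 : x = 0 := by
    obtain ⟨p, q, rfl⟩ := K00.exists_eq_sub x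
    obtain ⟨k, ⟨p', hp', hpp'⟩, ⟨q', hq', hqq'⟩⟩ :=
      ((eventually_exists_projection_class_eq hF h hθ p).and
        (eventually_exists_projection_class_eq hF h hθ q)).exists
    rw [hpp', hqq'] at hx0 ⊢
    rw [map_sub, sub_eq_zero, K00.map_of, K00.map_of] at hx0
    exact sub_eq_zero.2 ((h k).proj_eq _ hp' _ hq' hx0 θ (hFθ _) p' q' rfl rfl)
  have hy1 : y.toMul = 1 := by
    obtain ⟨n, u, hu⟩ := K11.exists_eq_mk y.toMul
    obtain ⟨k, v, hv, huv⟩ := (eventually_exists_unitary_class_eq hF h hθ u).exists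
    rw [hu, huv] at hy0 ⊢
    exact (h k).unitary_eq n _ hv hy0 θ (hFθ _) v rfl
  exact Prod.ext (Subtype.ext hx1) (Additive.toMul.injective hy1)

end CStarKTheory

open CStarKTheory TopologicalSpace in
/-- If `K_*(A)` is countable, there is an ascending sequence `F 0 ≤ F 1 ≤ …` of separable
C*-subalgebras of `A`, each of which surjects on `K_*`, such that their limit `θ`, the closure of
the union, is separable and its inclusion in `A` induces an isomorphism on `K_*`. -/
theorem theorem10p6 {A : Type*} [NonUnitalCStarAlgebra A]
    (hA : Countable (CStarKTheory.KStar A)) :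
    ∃ (F : ℕ → NonUnitalStarSubalgebra ℂ A) (_ : ∀ n, IsClosed (F n : Set A))
      (θ : NonUnitalStarSubalgebra ℂ A) (_ : IsClosed (θ : Set A)),
      Monotone F ∧
      (∀ n, TopologicalSpace.SeparableSpace (F n)) ∧
      (∀ n, Function.Surjective
        (CStarKTheory.KStar.map (NonUnitalStarSubalgebraClass.subtype (R := ℂ) (F n)))) ∧
      (θ : Set A) = closure (⋃ n, (F n : Set A)) ∧
      TopologicalSpace.SeparableSpace θ ∧
      Function.Bijective
        (CStarKTheory.KStar.map (NonUnitalStarSubalgebraClass.subtype (R := ℂ) θ)) := by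
  obtain ⟨T, hTc, hT⟩ := KStar.exists_countable_surjective hA
  obtain ⟨F₀, hF₀c, hF₀s, hTF₀⟩ := exists_separable_subalgebra hTc.isSeparable
  have step : ∀ F : {F : NonUnitalStarSubalgebra ℂ A // IsClosed (F : Set A) ∧
      IsSeparable (F : Set A)}, ∃ F' : {F : NonUnitalStarSubalgebra ℂ A // IsClosed (F : Set A) ∧
      IsSeparable (F : Set A)}, ∃ D E, IsEnlargement F.1 F'.1 D E := fun F =>
    let ⟨F', h1, h2, h3⟩ := exists_isEnlargement F.2.2
    ⟨⟨F', h1, h2⟩, h3⟩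
  -- The data chosen for `F` depend on `F` alone, so the sequence is the iteration of `next`.
  choose next D E hnext using step
  let F : ℕ → {F : NonUnitalStarSubalgebra ℂ A // IsClosed (F : Set A) ∧
      IsSeparable (F : Set A)} := fun n => Nat.rec ⟨F₀, hF₀c, hF₀s⟩ (fun _ => next) n
  have hF : ∀ k, IsEnlargement (F k).1 (F (k + 1)).1 (D (F k)) (E (F k)) := fun k => hnext (F k)
  have hmono : Monotone fun n => (F n).1 := monotone_nat_of_le_succ fun k => (hF k).le
  have hTF : ∀ n, T ⊆ (F n).1 := fun n => hTF₀.trans (hmono (Nat.zero_le n))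
  have hθ : ((⨆ n, (F n).1).topologicalClosure : Set A) = closure (⋃ n, ((F n).1 : Set A)) :=
    congrArg closure (NonUnitalStarSubalgebra.coe_iSup_of_directed hmono.directed_le)
  have hc := (⨆ n, (F n).1).isClosed_topologicalClosure
  have hFc : ∀ n, IsClosed ((F n).1 : Set A) := fun n => (F n).2.1
  have hs : IsSeparable ((⨆ n, (F n).1).topologicalClosure : Set A) := by
    rw [hθ]
    exact (IsSeparable.iUnion fun n => (F n).2.2).closure
  exact ⟨fun n => (F n).1, hFc, _, hc, hmono, fun n => (F n).2.2.separableSpace,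
    fun n => hT _ (hTF n), hθ, hs.separableSpace, KStar.map_injective hmono hF hθ,
    hT _ ((hTF 0).trans (le_of_coe_eq_closure hθ 0))⟩
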